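/- A dual quaternion is $q=q_{st}+q_I\epsilon$ with quaternions $q_{st},q_I$ (its standard and infinitesimal parts), where $\epsilon^2=0$ and $\epsilon$ commutes with quaternions; its conjugate is $q^*=q_{st}^*+q_I^*\epsilon$. A dual number is a dual quaternion $a+b\epsilon$ with $a,b\in\mathbb R$. For a square dual quaternion matrix $A=A_{st}+A_I\epsilon$ with $A_{st},A_I$ quaternion matrices, $A^*$ denotes the conjugate transpose; $A$ is Hermitian if $A^*=A$ and unitary if $A^*A=I$ (equivalently, $A^*A=AA^*=I$). A dual quaternion vector is appreciable if one of its entries has nonzero standard part. A dual number $\lambda$ is an eigenvalue of $A$, with eigenvector $\mathbf x$, if $\mathbf x$ is appreciable and $A\mathbf x=\mathbf x\lambda$. A quaternion $q$ is a right eigenvalue of a quaternion matrix $B$ if $B\mathbf x=\mathbf xq$ for some nonzero quaternion vector $\mathbf x$; the multiplicity of a real right eigenvalue $t$ of a Hermitian $B$ is the dimension of the right quaternionic vector space $\{\mathbf x: B\mathbf x=\mathbf xt\}$. **Theorem.** Let $A=A_{st}+A_I\epsilon$ be an $n\times n$ dual quaternion Hermitian matrix. Then there are an $n\times n$ dual quaternion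 unitary matrix $U$ and a diagonal $n\times n$ matrix $\Sigma$ of dual numbers such that $U^*AU=\Sigma$ and $$\Sigma=\mathrm{diag}\left(\lambda_1+\lambda_{1,1}\epsilon,\ \dots,\ \lambda_1+\lambda_{1,k_1}\epsilon,\ \lambda_2+\lambda_{2,1}\epsilon,\ \dots,\ \lambda_r+\lambda_{r,k_r}\epsilon\right),$$ where $k_1,\dots,k_r\ge 1$, $k_1+\dots+k_r=n$, and: 1. $\lambda_1>\lambda_2>\dots>\lambda_r$ are real numbers; they are exactly the distinct right eigenvalues of the quaternion matrix $A_{st}$, and $\lambda_i$ has multiplicity $k_i$; 2. $\lambda_{i,1}\ge\lambda_{i,2}\ge\dots\ge\lambda_{i,k_i}$ are real numbers for each $i$; 3. writing $U=(\mathbf u_{1,1},\dots,\mathbf u_{1,k_1},\dots,\mathbf u_{r,k_r})$ by columns, each $\lambda_i+\lambda_{i,j}\epsilon$ is an eigenvalue of $A$ with eigenvector $\mathbf u_{i,j}$; that is, $\mathbf u_{i,j}$ is appreciable and $A\mathbf u_{i,j}=\mathbf u_{i,j}(\lambda_i+\lambda_{i,j}\epsilon)$. Moreover $\Sigma$ is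 unique, counting multiplicities. If $V$ is unitary and $V^*AV$ is a diagonal matrix of dual numbers, then its diagonal entries are those of $\Sigma$ up to a permutation. If moreover $V^*AV=\mathrm{diag}(\lambda'_1+\lambda'_{1,1}\epsilon,\dots,\lambda'_{r'}+\lambda'_{r',k'_{r'}}\epsilon)$ with real $\lambda'_1>\dots>\lambda'_{r'}$, with $k'_i\ge1$, and with real $\lambda'_{i,1}\ge\dots\ge\lambda'_{i,k'_i}$ for each $i$, then $r'=r$, $\lambda'_i=\lambda_i$, $k'_i=k_i$ and $\lambda'_{i,j}=\lambda_{i,j}$ for all $i,j$. -/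

import Mathlib

open scoped Matrix

/-- Dual quaternions `q = q_st + q_I ε` with quaternions `q_st = q.fst` and `q_I = q.snd`, where
`ε ^ 2 = 0` and `ε` commutes with the quaternions. -/
abbrev DualQuaternion : Type := DualNumber (Quaternion ℝ)

namespace DualQuaternion

/-- The conjugate `q^* = q_st^* + q_I^* ε`. -/
noncomputable instance instStarRing : StarRing DualQuaternion where
  star q := TrivSqZeroExt.inl (star q.fst) + TrivSqZeroExt.inr (star q.snd)
  star_involutive q := by ext1 <;> simp
  star_mul p q := by
    ext1
    · simp
    · simp [add_comm]
  star_add p q := by ext1 <;> simp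

/-- The inclusion of the dual numbers `a + b ε`, with `a` and `b` real, into the dual
quaternions. -/
noncomputable def ofDual (d : DualNumber ℝ) : DualQuaternion :=
  TrivSqZeroExt.inl (d.fst : Quaternion ℝ) + TrivSqZeroExt.inr (d.snd : Quaternion ℝ)

variable {n : ℕ}

/-- The standard part of a dual quaternion matrix. -/
def standardPart (A : Matrix (Fin n) (Fin n) DualQuaternion) :
    Matrix (Fin n) (Fin n) (Quaternion ℝ) :=
  A.map TrivSqZeroExt.fst

/-- `x` is a right eigenvector of the dual quaternion matrix `A` for `q`: the vector `x` is
appreciable (some entry has a nonzero standard part) and `A x = x q`. When `q` is a dual number,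
`q` is then an eigenvalue of `A`. -/
def IsRightEigenvector (A : Matrix (Fin n) (Fin n) DualQuaternion) (q : DualQuaternion)
    (x : Fin n → DualQuaternion) : Prop :=
  (∃ a, (x a).fst ≠ 0) ∧ A *ᵥ x = fun a => x a * q

/-- `q` is a right eigenvalue of the quaternion matrix `B`. -/
def IsQuaternionRightEigenvalue (B : Matrix (Fin n) (Fin n) (Quaternion ℝ))
    (q : Quaternion ℝ) : Prop :=
  ∃ x : Fin n → Quaternion ℝ, x ≠ 0 ∧ B *ᵥ x = fun a => x a * q

/-- For a real number `t`, the right quaternionic subspace of all `x` with `B x = x t`. Right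
quaternionic vector spaces are modules over the opposite ring. -/
def realEigenspace (B : Matrix (Fin n) (Fin n) (Quaternion ℝ)) (t : ℝ) :
    Submodule (Quaternion ℝ)ᵐᵒᵖ (Fin n → Quaternion ℝ) where
  carrier := {x | B *ᵥ x = fun a => x a * (t : Quaternion ℝ)}
  add_mem' {x y} hx hy := by
    simp only [Set.mem_ofPred_eq] at hx hy ⊢
    rw [Matrix.mulVec_add, hx, hy]
    funext a
    simp [add_mul]
  zero_mem' := by
    simp only [Set.mem_ofPred_eq, Matrix.mulVec_zero]
    funext a
    simp
  smul_mem' c x hx := by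
    simp only [Set.mem_ofPred_eq] at hx ⊢
    rw [Matrix.mulVec_smul, hx]
    funext a
    simp only [Pi.smul_apply, MulOpposite.smul_eq_mul_unop, mul_assoc]
    rw [Quaternion.coe_commutes]

/-- The multiplicity of a real number `t` as a right eigenvalue of a quaternion Hermitian matrix:
the dimension over the quaternions of its eigenspace. -/
noncomputable def eigenvalueMultiplicity (B : Matrix (Fin n) (Fin n) (Quaternion ℝ))
    (t : ℝ) : ℕ :=
  Module.finrank (Quaternion ℝ)ᵐᵒᵖ (realEigenspace B t)

/-- The data of an ordered diagonal form of size `n`: real numbers `λ_1 > ⋯ > λ_r`, sizes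
`k_1, …, k_r ≥ 1` with sum `n`, and for each `i` real numbers `λ_{i,1} ≥ ⋯ ≥ λ_{i,k_i}`. -/
structure DiagonalForm (n : ℕ) where
  /-- the number `r` of blocks -/
  r : ℕ
  /-- the numbers `λ_i` -/
  lam : Fin r → ℝ
  /-- the sizes `k_i` -/
  k : Fin r → ℕ
  /-- the numbers `λ_{i,j}` -/
  mu : (i : Fin r) → Fin (k i) → ℝ
  k_pos : ∀ i, 0 < k i
  sum_k : ∑ i, k i = n
  lam_strictAnti : StrictAnti lam
  mu_antitone : ∀ i, Antitone (mu i)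

namespace DiagonalForm

/-- The position of `(i, j)` in the list `(1,1), …, (1,k_1), (2,1), …, (r,k_r)`. -/
def position (F : DiagonalForm n) : (Σ i : Fin F.r, Fin (F.k i)) ≃ Fin n :=
  finSigmaFinEquiv.trans (finCongr F.sum_k)

/-- The dual number `λ_i + λ_{i,j} ε`. -/
def entry (F : DiagonalForm n) (i : Fin F.r) (j : Fin (F.k i)) : DualNumber ℝ :=
  TrivSqZeroExt.inl (F.lam i) + TrivSqZeroExt.inr (F.mu i j)

/-- The diagonal
`λ_1 + λ_{1,1} ε, …, λ_1 + λ_{1,k_1} ε, λ_2 + λ_{2,1} ε, …, λ_r + λ_{r,k_r} ε`. -/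
def diag (F : DiagonalForm n) (p : Fin n) : DualNumber ℝ :=
  F.entry (F.position.symm p).1 (F.position.symm p).2

/-- The diagonal dual number matrix `Σ`. -/
def toMatrix (F : DiagonalForm n) : Matrix (Fin n) (Fin n) (DualNumber ℝ) :=
  Matrix.diagonal F.diag

end DiagonalForm

end DualQuaternion

/-! Existence. A quaternion unitary diagonalizes the standard part, giving D + Cε with D real
diagonal. Conjugating by the unitary I + Xε with X anti-Hermitian replaces C by C + DX - XD, and X
can be chosen to kill every entry of C linking distinct eigenvalues
(`exists_unitary_commuting_parts`). What remains commutes with D, so a further quaternion unitary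
diagonalizes both parts at once (`exists_unitary_joint_diagonalization`); permuting columns sorts
the diagonal.

Uniqueness. Two diagonalizations are intertwined by W = U*V. Dual numbers are central, so an entry
of W with nonzero standard part forces equality of the two diagonal entries it links. The squared
moduli of the entries of the standard part of W form a doubly stochastic matrix, so each value
occurs equally often on both diagonals (`exists_perm_of_unitary`), and an ordered form is determined
by its multiset of entries (`eq_of_equiv`). -/

theorem LinearMap.IsSymmetric.exists_joint_eigenvector {E : Type*} [NormedAddCommGroup E]
    [InnerProductSpace ℝ E] [FiniteDimensional ℝ E] {S T : E →ₗ[ℝ] E} (hS : S.IsSymmetric)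
    (hT : T.IsSymmetric) (hST : Commute S T) [Nontrivial E] :
    ∃ x ≠ 0, ∃ b c : ℝ, S x = b • x ∧ T x = c • x := by
  by_contra! h
  have htop := LinearMap.IsSymmetric.iSup_iSup_eigenspace_inf_eigenspace_eq_top_of_commute
    hS hT hST
  have hbot : ∀ b c : ℝ, Module.End.eigenspace S b ⊓ Module.End.eigenspace T c = ⊥ := by
    intro b c
    rw [Submodule.eq_bot_iff]
    rintro x ⟨hx, hx'⟩
    by_contra hne
    exact h x hne b c (Module.End.mem_eigenspace_iff.1 hx) (Module.End.mem_eigenspace_iff.1 hx')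
  simp only [hbot, iSup_bot] at htop
  exact bot_ne_top htop

theorem LinearMap.IsSymmetric.exists_joint_eigenvector_mem {E : Type*} [NormedAddCommGroup E]
    [InnerProductSpace ℝ E] [FiniteDimensional ℝ E] {S T : E →ₗ[ℝ] E} (hS : S.IsSymmetric)
    (hT : T.IsSymmetric) (hST : Commute S T) {W : Submodule ℝ E} (hW : W ≠ ⊥)
    (hSW : ∀ x ∈ W, S x ∈ W) (hTW : ∀ x ∈ W, T x ∈ W) :
    ∃ x ∈ W, x ≠ 0 ∧ ∃ b c : ℝ, S x = b • x ∧ T x = c • x := by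
  have := Submodule.nontrivial_iff_ne_bot.2 hW
  obtain ⟨x, hx, b, c, hb, hc⟩ := (hS.restrict_invariant hSW).exists_joint_eigenvector
    (hT.restrict_invariant hTW) (by
      ext x
      exact congrArg (fun f : E →ₗ[ℝ] E => f x) hST)
  exact ⟨x, x.2, by simpa using hx, b, c, congrArg Subtype.val hb, congrArg Subtype.val hc⟩

/-! ### Joint diagonalization of commuting quaternion Hermitian matrices -/

namespace Quaternion

theorem re_sum {κ : Type*} (s : Finset κ) (f : κ → Quaternion ℝ) :
    (∑ i ∈ s, f i).re = ∑ i ∈ s, (f i).re :=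
  map_sum (AddMonoidHom.mk' (fun q : Quaternion ℝ => q.re) Quaternion.re_add) f s

theorem star_real_smul {κ : Type*} (c : ℝ) (x : κ → Quaternion ℝ) : star (c • x) = c • star x := by
  ext1 i
  simp

variable {ι : Type*} [Fintype ι]

/-- Left multiplication by a quaternion matrix, as a real linear operator. -/
noncomputable def mulVecReal (B : Matrix ι ι (Quaternion ℝ)) :
    PiLp 2 (fun _ : ι => Quaternion ℝ) →ₗ[ℝ] PiLp 2 (fun _ : ι => Quaternion ℝ) where
  toFun x := WithLp.toLp 2 (B *ᵥ x.ofLp)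
  map_add' x y := by simp [Matrix.mulVec_add]
  map_smul' c x := by simp [Matrix.mulVec_smul]

/-- Links the quaternionic form to a real inner product, so that the real spectral theorem applies
to quaternion Hermitian matrices. -/
theorem inner_eq_re_dotProduct (x y : PiLp 2 (fun _ : ι => Quaternion ℝ)) :
    inner ℝ x y = (star y.ofLp ⬝ᵥ x.ofLp).re := by
  simp only [PiLp.inner_apply, Quaternion.inner_def, dotProduct, Pi.star_apply]
  rw [re_sum]
  refine Finset.sum_congr rfl fun i _ => ?_
  simp
  ring

theorem isSymmetric_mulVecReal {B : Matrix ι ι (Quaternion ℝ)} (hB : B.IsHermitian) :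
    (mulVecReal B).IsSymmetric := by
  intro x y
  simp only [inner_eq_re_dotProduct, mulVecReal, LinearMap.coe_mk, AddHom.coe_mk]
  rw [Matrix.star_mulVec, hB.eq, Matrix.dotProduct_mulVec]

theorem star_dotProduct_self (x : ι → Quaternion ℝ) :
    star x ⬝ᵥ x = ((∑ i, normSq (x i) : ℝ) : Quaternion ℝ) := by
  rw [← Quaternion.algebraMap_def, map_sum]
  simp [dotProduct, Quaternion.star_mul_self, Quaternion.algebraMap_def]

theorem exists_normalized {x : ι → Quaternion ℝ} (hx : x ≠ 0) :
    ∃ c : ℝ, star (c • x) ⬝ᵥ (c • x) = 1 := by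
  have hpos : 0 < ∑ i, normSq (x i) := by
    obtain ⟨i, hi⟩ := Function.ne_iff.1 hx
    exact Finset.sum_pos' (fun i _ => normSq_nonneg)
      ⟨i, Finset.mem_univ _, lt_of_le_of_ne normSq_nonneg fun h => hi (normSq_eq_zero.1 h.symm)⟩
  refine ⟨(√(∑ i, normSq (x i)))⁻¹, ?_⟩
  rw [star_real_smul, smul_dotProduct, dotProduct_smul, star_dotProduct_self, smul_smul,
    ← mul_inv, Real.mul_self_sqrt hpos.le, ← Quaternion.coe_smul, smul_eq_mul,
    inv_mul_cancel₀ hpos.ne', Quaternion.coe_one]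

/-- Move `B` to the left factor, where it acts as a real scalar. Hence the quaternionic orthogonal
complement of eigenvectors is invariant. -/
theorem star_smul_dotProduct_eq_zero {B : Matrix ι ι (Quaternion ℝ)} (hB : B.IsHermitian)
    {v x : ι → Quaternion ℝ} {b : ℝ} (hv : B *ᵥ v = b • v) (h : star v ⬝ᵥ x = 0) :
    star v ⬝ᵥ (B *ᵥ x) = 0 := by
  rw [Matrix.dotProduct_mulVec, ← hB.eq, ← Matrix.star_mulVec, hv, star_real_smul, smul_dotProduct, h,
    smul_zero]

/-- The quaternionic orthogonality conditions cut out the kernel of a real linear map from dimension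
4n to dimension 4k, where n is the size of the matrices. It is nonzero and invariant under both
operators, hence contains a joint eigenvector. -/
theorem exists_joint_eigenvector_orthogonal {B C : Matrix ι ι (Quaternion ℝ)}
    (hB : B.IsHermitian) (hC : C.IsHermitian) (hBC : B * C = C * B) {k : ℕ}
    (hk : k < Fintype.card ι) (v : Fin k → ι → Quaternion ℝ)
    (hv : ∀ i, ∃ b c : ℝ, B *ᵥ v i = b • v i ∧ C *ᵥ v i = c • v i) :
    ∃ x : ι → Quaternion ℝ, star x ⬝ᵥ x = 1 ∧ (∀ i, star (v i) ⬝ᵥ x = 0) ∧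
      ∃ b c : ℝ, B *ᵥ x = b • x ∧ C *ᵥ x = c • x := by
  let f : PiLp 2 (fun _ : ι => Quaternion ℝ) →ₗ[ℝ] (Fin k → Quaternion ℝ) :=
    { toFun := fun x i => star (v i) ⬝ᵥ x.ofLp
      map_add' := fun x y => by ext1 i; simp [dotProduct_add]
      map_smul' := fun c x => by ext1 i; simp [dotProduct_smul] }
  have hf : LinearMap.ker f ≠ ⊥ := by
    apply LinearMap.ker_ne_bot_of_finrank_lt
    rw [(WithLp.linearEquiv 2 ℝ (ι → Quaternion ℝ)).finrank_eq, Module.finrank_pi_fintype,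
      Module.finrank_pi_fintype]
    simp [Quaternion.finrank_eq_four, hk]
  have hmem : ∀ x, x ∈ LinearMap.ker f ↔ ∀ i, star (v i) ⬝ᵥ x.ofLp = 0 := fun x => by
    rw [LinearMap.mem_ker, funext_iff]; rfl
  obtain ⟨x, hxf, hx, b, c, hb, hc⟩ :=
    (isSymmetric_mulVecReal hB).exists_joint_eigenvector_mem (isSymmetric_mulVecReal hC) (by
      ext1 x
      simp [mulVecReal, hBC]) hf
      (fun x hx => (hmem _).2 fun i => by
        obtain ⟨b, _, hb, _⟩ := hv i
        exact star_smul_dotProduct_eq_zero hB hb ((hmem x).1 hx i))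
      (fun x hx => (hmem _).2 fun i => by
        obtain ⟨_, c, _, hc⟩ := hv i
        exact star_smul_dotProduct_eq_zero hC hc ((hmem x).1 hx i))
  obtain ⟨t, ht⟩ := exists_normalized (x := x.ofLp) (by simpa using hx)
  refine ⟨t • x.ofLp, ht, fun i => ?_, b, c, ?_, ?_⟩
  · rw [dotProduct_smul, (hmem x).1 hxf i, smul_zero]
  · rw [Matrix.mulVec_smul, smul_comm b t]
    exact congrArg (t • ·) (congrArg WithLp.ofLp hb)
  · rw [Matrix.mulVec_smul, smul_comm c t]
    exact congrArg (t • ·) (congrArg WithLp.ofLp hc)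

theorem exists_orthonormal_joint_eigenvectors {B C : Matrix ι ι (Quaternion ℝ)}
    (hB : B.IsHermitian) (hC : C.IsHermitian) (hBC : B * C = C * B) (k : ℕ)
    (hk : k ≤ Fintype.card ι) :
    ∃ v : Fin k → ι → Quaternion ℝ,
      (∀ i j, star (v i) ⬝ᵥ v j = if i = j then 1 else 0) ∧
      ∀ i, ∃ b c : ℝ, B *ᵥ v i = b • v i ∧ C *ᵥ v i = c • v i := by
  induction k with
  | zero => exact ⟨Fin.elim0, fun i => i.elim0, fun i => i.elim0⟩
  | succ k ih =>
    obtain ⟨v, hv, hBCv⟩ := ih (by lia)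
    obtain ⟨x, hx, hvx, hBCx⟩ := exists_joint_eigenvector_orthogonal hB hC hBC hk v hBCv
    have hxv : ∀ i, star x ⬝ᵥ v i = 0 := fun i => by
      have h := congrArg star (hvx i)
      rwa [Matrix.star_dotProduct, star_zero, star_star] at h
    refine ⟨Fin.cons x v, ?_, ?_⟩
    · intro i j
      cases i using Fin.cases <;> cases j using Fin.cases <;>
        simp [hx, hvx, hxv, hv, Fin.succ_ne_zero, (Fin.succ_ne_zero _).symm]
    · intro i
      cases i using Fin.cases
      · simpa using hBCx
      · simpa using hBCv _

/-- Two commuting quaternion Hermitian matrices have a common unitary diagonalization with real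
diagonals. -/
theorem exists_unitary_joint_diagonalization {n : ℕ} {B C : Matrix (Fin n) (Fin n) (Quaternion ℝ)}
    (hB : B.IsHermitian) (hC : C.IsHermitian) (hBC : B * C = C * B) :
    ∃ (P : Matrix (Fin n) (Fin n) (Quaternion ℝ)) (b c : Fin n → ℝ), Pᴴ * P = 1 ∧
      Pᴴ * B * P = Matrix.diagonal (fun a => (b a : Quaternion ℝ)) ∧
      Pᴴ * C * P = Matrix.diagonal (fun a => (c a : Quaternion ℝ)) := by
  obtain ⟨v, hv, h⟩ := exists_orthonormal_joint_eigenvectors hB hC hBC n (by simp)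
  choose b c hb hc using h
  have key : ∀ (M : Matrix (Fin n) (Fin n) (Quaternion ℝ)) (m : Fin n → ℝ),
      (∀ i, M *ᵥ v i = m i • v i) →
      (Matrix.of fun a i => v i a)ᴴ * M * (Matrix.of fun a i => v i a) =
        Matrix.diagonal (fun a => (m a : Quaternion ℝ)) := by
    intro M m hM
    ext1 i j
    have h : ((Matrix.of fun a i => v i a)ᴴ * (M * (Matrix.of fun a i => v i a))) i j =
      star (v i) ⬝ᵥ (M *ᵥ v j) := rfl
    rw [Matrix.mul_assoc, h, hM, dotProduct_smul, hv, Matrix.diagonal_apply]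
    by_cases hij : i = j
    · subst hij
      simp [Algebra.smul_def, Quaternion.algebraMap_def]
    · simp [hij]
  refine ⟨Matrix.of fun a i => v i a, b, c, ?_, key B b hb, key C c hc⟩
  have h1 := key 1 1 (by simp)
  simpa using h1

end Quaternion

/-! ### Unitary diagonalization of dual quaternion Hermitian matrices -/

namespace DualQuaternion

variable {n : ℕ}

/-- The infinitesimal part of a dual quaternion matrix. -/
def infinitesimalPart (A : Matrix (Fin n) (Fin n) DualQuaternion) :
    Matrix (Fin n) (Fin n) (Quaternion ℝ) :=
  A.map TrivSqZeroExt.snd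

/-- The dual quaternion matrix with given standard and infinitesimal parts. -/
def ofParts (B C : Matrix (Fin n) (Fin n) (Quaternion ℝ)) :
    Matrix (Fin n) (Fin n) DualQuaternion :=
  Matrix.of fun a b => (B a b, C a b)

@[simp]
theorem standardPart_ofParts (B C : Matrix (Fin n) (Fin n) (Quaternion ℝ)) :
    standardPart (ofParts B C) = B := rfl

@[simp]
theorem infinitesimalPart_ofParts (B C : Matrix (Fin n) (Fin n) (Quaternion ℝ)) :
    infinitesimalPart (ofParts B C) = C := rfl

theorem matrix_ext {M N : Matrix (Fin n) (Fin n) DualQuaternion}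
    (h : standardPart M = standardPart N) (h' : infinitesimalPart M = infinitesimalPart N) :
    M = N := by
  ext1 a b
  exact TrivSqZeroExt.ext (congrFun₂ h a b) (congrFun₂ h' a b)

@[simp]
theorem standardPart_one :
    standardPart (1 : Matrix (Fin n) (Fin n) DualQuaternion) = 1 := by
  ext1 a b
  by_cases h : a = b <;> simp [standardPart, Matrix.one_apply, h]

@[simp]
theorem infinitesimalPart_one :
    infinitesimalPart (1 : Matrix (Fin n) (Fin n) DualQuaternion) = 0 := by
  ext1 a b
  by_cases h : a = b <;> simp [infinitesimalPart, h]

@[simp]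
theorem standardPart_mul (M N : Matrix (Fin n) (Fin n) DualQuaternion) :
    standardPart (M * N) = standardPart M * standardPart N := by
  ext1 a b
  simp [standardPart, Matrix.mul_apply, TrivSqZeroExt.fst_sum]

@[simp]
theorem infinitesimalPart_mul (M N : Matrix (Fin n) (Fin n) DualQuaternion) :
    infinitesimalPart (M * N) =
      standardPart M * infinitesimalPart N + infinitesimalPart M * standardPart N := by
  ext1 a b
  simp [standardPart, infinitesimalPart, Matrix.mul_apply, TrivSqZeroExt.snd_sum,
    Finset.sum_add_distrib]

theorem fst_star (q : DualQuaternion) : (star q).fst = star q.fst := by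
  change (TrivSqZeroExt.inl (star q.fst) + TrivSqZeroExt.inr (star q.snd)).fst = _
  simp

theorem snd_star (q : DualQuaternion) : (star q).snd = star q.snd := by
  change (TrivSqZeroExt.inl (star q.fst) + TrivSqZeroExt.inr (star q.snd)).snd = _
  simp

@[simp]
theorem standardPart_conjTranspose (M : Matrix (Fin n) (Fin n) DualQuaternion) :
    standardPart Mᴴ = (standardPart M)ᴴ := by
  ext1 a b
  exact fst_star _

@[simp]
theorem infinitesimalPart_conjTranspose (M : Matrix (Fin n) (Fin n) DualQuaternion) :
    infinitesimalPart Mᴴ = (infinitesimalPart M)ᴴ := by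
  ext1 a b
  exact snd_star _

@[simp]
theorem ofDual_zero : ofDual 0 = 0 := by
  simp [ofDual]

theorem map_ofDual_diagonal (d : Fin n → DualNumber ℝ) :
    (Matrix.diagonal d).map ofDual = Matrix.diagonal fun a => ofDual (d a) := by
  rw [Matrix.diagonal_map ofDual_zero]

theorem standardPart_diagonal (d : Fin n → DualNumber ℝ) :
    standardPart ((Matrix.diagonal d).map ofDual) =
      Matrix.diagonal fun a => ((d a).fst : Quaternion ℝ) := by
  ext1 a b
  by_cases h : a = b <;> simp [standardPart, h, ofDual]

theorem infinitesimalPart_diagonal (d : Fin n → DualNumber ℝ) :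
    infinitesimalPart ((Matrix.diagonal d).map ofDual) =
      Matrix.diagonal fun a => ((d a).snd : Quaternion ℝ) := by
  ext1 a b
  by_cases h : a = b <;> simp [infinitesimalPart, h, ofDual]

theorem isHermitian_parts {A : Matrix (Fin n) (Fin n) DualQuaternion} (hA : A.IsHermitian) :
    (standardPart A).IsHermitian ∧ (infinitesimalPart A).IsHermitian :=
  ⟨by rw [Matrix.IsHermitian, ← standardPart_conjTranspose, hA.eq],
    by rw [Matrix.IsHermitian, ← infinitesimalPart_conjTranspose, hA.eq]⟩

/-- A left-unitary dual quaternion matrix is right-unitary. -/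
theorem mul_conjTranspose_eq_one {U : Matrix (Fin n) (Fin n) DualQuaternion} (hU : Uᴴ * U = 1) :
    U * Uᴴ = 1 := by
  have hst : standardPart U * (standardPart U)ᴴ = 1 := by
    rw [mul_eq_one_comm, ← standardPart_conjTranspose, ← standardPart_mul, hU, standardPart_one]
  -- An idempotent 1 + Yε satisfies 1 + 2Yε = 1 + Yε, so Y = 0.
  have hidem : (U * Uᴴ) * (U * Uᴴ) = U * Uᴴ := by
    rw [Matrix.mul_assoc, ← Matrix.mul_assoc Uᴴ, hU, Matrix.one_mul]
  have hst' : standardPart (U * Uᴴ) = 1 := by simpa using hst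
  refine matrix_ext (by simpa using hst) ?_
  have h := congrArg infinitesimalPart hidem
  rw [infinitesimalPart_mul (U * Uᴴ), hst', Matrix.one_mul, Matrix.mul_one] at h
  rw [infinitesimalPart_one]
  exact left_eq_add.1 h.symm

/-- After a unitary conjugation the infinitesimal part of a dual quaternion Hermitian matrix with
real diagonal standard part commutes with the standard part. -/
theorem exists_unitary_commuting_parts {A : Matrix (Fin n) (Fin n) DualQuaternion}
    (hA : A.IsHermitian) {d : Fin n → ℝ}
    (hd : standardPart A = Matrix.diagonal fun a => (d a : Quaternion ℝ)) :
    ∃ U : Matrix (Fin n) (Fin n) DualQuaternion, Uᴴ * U = 1 ∧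
      standardPart (Uᴴ * A * U) = standardPart A ∧
      standardPart A * infinitesimalPart (Uᴴ * A * U) =
        infinitesimalPart (Uᴴ * A * U) * standardPart A := by
  set C := infinitesimalPart A with hC
  have hCH : ∀ a b, star (C b a) = C a b := fun a b => (isHermitian_parts hA).2.apply a b
  -- Solves (d a - d b) X a b = -C a b when `d a ≠ d b`. When they agree, `0⁻¹ = 0` makes the entry
  -- of `X` vanish and leaves that of `C` unchanged.
  let X : Matrix (Fin n) (Fin n) (Quaternion ℝ) := Matrix.of fun a b => (d b - d a)⁻¹ • C a b
  have hX : Xᴴ = -X := by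
    ext1 a b
    simp only [X, Matrix.conjTranspose_apply, Matrix.of_apply, Matrix.neg_apply,
      Quaternion.star_smul, hCH, ← neg_smul, ← inv_neg, neg_sub]
  have hst : standardPart ((ofParts 1 X)ᴴ * A * ofParts 1 X) = standardPart A := by simp
  have hinf : infinitesimalPart ((ofParts 1 X)ᴴ * A * ofParts 1 X) =
      standardPart A * X + (C - X * standardPart A) := by
    simp [hX, hC, sub_eq_add_neg]
  refine ⟨ofParts 1 X, matrix_ext (by simp) (by simp [hX]), hst, ?_⟩
  rw [hinf, hd]
  ext1 a b
  rw [Matrix.diagonal_mul, Matrix.mul_diagonal]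
  simp only [Matrix.add_apply, Matrix.sub_apply, Matrix.diagonal_mul, Matrix.mul_diagonal, X,
    Matrix.of_apply, Quaternion.coe_mul_eq_smul, Quaternion.mul_coe_eq_smul, smul_smul,
    smul_add, smul_sub]
  by_cases h : d a = d b
  · simp [h]
  · have h' : d b - d a ≠ 0 := sub_ne_zero.2 (Ne.symm h)
    simp only [← sub_smul, ← add_smul]
    congr 1
    field_simp
    ring

theorem mul_conjTranspose_mul_self {U V : Matrix (Fin n) (Fin n) DualQuaternion}
    (hU : Uᴴ * U = 1) (hV : Vᴴ * V = 1) : (U * V)ᴴ * (U * V) = 1 := by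
  rw [Matrix.conjTranspose_mul, Matrix.mul_assoc, ← Matrix.mul_assoc Uᴴ, hU, Matrix.one_mul, hV]

theorem exists_unitary_diagonalization {A : Matrix (Fin n) (Fin n) DualQuaternion}
    (hA : A.IsHermitian) :
    ∃ (U : Matrix (Fin n) (Fin n) DualQuaternion) (d : Fin n → DualNumber ℝ), Uᴴ * U = 1 ∧
      Uᴴ * A * U = (Matrix.diagonal d).map ofDual := by
  -- Pairing with the zero matrix gives diagonalization of a single matrix.
  obtain ⟨P, b, -, hP, hPb, -⟩ := Quaternion.exists_unitary_joint_diagonalization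
    (isHermitian_parts hA).1 Matrix.isHermitian_zero (by simp)
  have hA₁ : ((ofParts P 0)ᴴ * A * ofParts P 0).IsHermitian :=
    Matrix.isHermitian_conjTranspose_mul_mul _ hA
  obtain ⟨X, hX, hXst, hXcomm⟩ := exists_unitary_commuting_parts hA₁ (d := b) (by simpa using hPb)
  have hA₂ := Matrix.isHermitian_conjTranspose_mul_mul X hA₁
  obtain ⟨Q, s, t, hQ, hQs, hQt⟩ := Quaternion.exists_unitary_joint_diagonalization
    (isHermitian_parts hA₁).1 (isHermitian_parts hA₂).2 hXcomm
  refine ⟨ofParts P 0 * X * ofParts Q 0, fun a => TrivSqZeroExt.inl (s a) + TrivSqZeroExt.inr (t a),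
    mul_conjTranspose_mul_self (mul_conjTranspose_mul_self
      (matrix_ext (by simpa using hP) (by simp)) hX)
      (matrix_ext (by simpa using hQ) (by simp)), ?_⟩
  have hassoc : (ofParts P 0 * X * ofParts Q 0)ᴴ * A * (ofParts P 0 * X * ofParts Q 0) =
      (ofParts Q 0)ᴴ * (Xᴴ * ((ofParts P 0)ᴴ * A * ofParts P 0) * X) * ofParts Q 0 := by
    simp only [Matrix.conjTranspose_mul, Matrix.mul_assoc]
  rw [hassoc]
  refine matrix_ext ?_ ?_
  · rw [standardPart_diagonal, standardPart_mul, standardPart_mul, hXst]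
    simpa using hQs
  · rw [infinitesimalPart_diagonal, infinitesimalPart_mul, infinitesimalPart_mul]
    simpa using hQt

end DualQuaternion

namespace DualQuaternion

variable {n : ℕ}

/-! ### Ordered diagonal forms: rigidity and sorting -/

namespace DiagonalForm

theorem diag_position (F : DiagonalForm n) (x : Σ i : Fin F.r, Fin (F.k i)) :
    F.diag (F.position x) = F.entry x.1 x.2 := by
  rw [diag, Equiv.symm_apply_apply]

@[simp]
theorem fst_entry (F : DiagonalForm n) (i : Fin F.r) (j : Fin (F.k i)) :
    (F.entry i j).fst = F.lam i := by
  simp [entry]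

@[simp]
theorem snd_entry (F : DiagonalForm n) (i : Fin F.r) (j : Fin (F.k i)) :
    (F.entry i j).snd = F.mu i j := by
  simp [entry]

theorem range_lam_subset {F G : DiagonalForm n}
    (e : (Σ i : Fin F.r, Fin (F.k i)) → Σ i : Fin G.r, Fin (G.k i))
    (he : ∀ x, F.entry x.1 x.2 = G.entry (e x).1 (e x).2) :
    Set.range F.lam ⊆ Set.range G.lam := by
  rintro _ ⟨i, rfl⟩
  have h := congrArg TrivSqZeroExt.fst (he ⟨i, ⟨0, F.k_pos i⟩⟩)
  simp only [fst_entry] at h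
  exact ⟨_, h.symm⟩

/-- Strictly decreasing enumerations of the same set coincide, so `e` preserves the block index and
restricts to a bijection on each block. Two antitone lists that are rearrangements of each other are
equal. -/
theorem eq_of_equiv {F G : DiagonalForm n}
    (e : (Σ i : Fin F.r, Fin (F.k i)) ≃ Σ i : Fin G.r, Fin (G.k i))
    (he : ∀ x, F.entry x.1 x.2 = G.entry (e x).1 (e x).2) : F = G := by
  have hrange : Set.range F.lam = Set.range G.lam :=
    (range_lam_subset e he).antisymm (range_lam_subset e.symm fun x => by
      rw [he, e.apply_symm_apply])
  have hlam : ∀ x, F.lam x.1 = G.lam (e x).1 := fun x => by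
    simpa only [fst_entry] using congrArg TrivSqZeroExt.fst (he x)
  have hmu : ∀ x, F.mu x.1 x.2 = G.mu (e x).1 (e x).2 := fun x => by
    simpa only [snd_entry] using congrArg TrivSqZeroExt.snd (he x)
  clear he
  obtain ⟨r, lam, k, mu, k_pos, sum_k, lam_anti, mu_anti⟩ := F
  obtain ⟨r', lam', k', mu', k_pos', sum_k', lam_anti', mu_anti'⟩ := G
  dsimp only at *
  obtain rfl : r = r' := by
    have h := congrArg Set.ncard hrange
    rwa [← Set.image_univ, ← Set.image_univ, Set.ncard_image_of_injective _ lam_anti.injective,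
      Set.ncard_image_of_injective _ lam_anti'.injective, Set.ncard_univ, Set.ncard_univ,
      Nat.card_fin, Nat.card_fin] at h
  obtain rfl : lam = lam' := (lam_anti.range_inj lam_anti').1 hrange
  have hfst : ∀ x, x.1 = (e x).1 := fun x => lam_anti.injective (hlam x)
  let σ (i : Fin r) : Fin (k i) ≃ Fin (k' i) :=
    (Equiv.sigmaSubtype i).symm.trans
      ((e.subtypeEquiv fun x => by rw [← hfst x]).trans (Equiv.sigmaSubtype i))
  have hσ : ∀ i j, mu i j = mu' i (σ i j) := by
    intro i j
    have key : ∀ y : {y : Σ i, Fin (k' i) // y.1 = i},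
        mu' y.1.1 y.1.2 = mu' i (Equiv.sigmaSubtype i y) := by
      rintro ⟨⟨i, j⟩, rfl⟩
      rfl
    exact (hmu ⟨i, j⟩).trans (key ⟨e ⟨i, j⟩, (hfst _).symm⟩)
  obtain rfl : k = k' := funext fun i => Fin.equiv_iff_eq.1 ⟨σ i⟩
  obtain rfl : mu = mu' := by
    funext i
    have h : mu i = mu' i ∘ σ i := funext (hσ i)
    have h' := Tuple.unique_antitone (f := mu' i) (σ := σ i) (τ := Equiv.refl _)
      (h ▸ mu_anti i) (mu_anti' i)
    exact h.trans h'
  rfl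

theorem eq_of_diag_eq_comp_perm {F G : DiagonalForm n} (s : Equiv.Perm (Fin n))
    (hs : ∀ p, F.diag p = G.diag (s p)) : F = G := by
  refine eq_of_equiv ((F.position.trans s).trans G.position.symm) fun x => ?_
  rw [← diag_position, hs, ← diag_position]
  simp

/-- Every list of dual numbers can be rearranged into an ordered diagonal form. -/
theorem exists_diag_eq_comp_perm (d : Fin n → DualNumber ℝ) :
    ∃ (F : DiagonalForm n) (s : Equiv.Perm (Fin n)), ∀ p, F.diag p = d (s p) := by
  classical
  let L : Finset ℝ := Finset.univ.image fun p => (d p).fst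
  -- `orderEmbOfFin` is increasing; `rev` makes the enumeration decreasing. The negation in `σ`
  -- below plays the same role inside a block.
  let lam : Fin L.card → ℝ := fun i => L.orderEmbOfFin rfl i.rev
  have hlam : StrictAnti lam := fun i j hij =>
    (L.orderEmbOfFin rfl).strictMono (Fin.rev_lt_rev.2 hij)
  have hg : ∀ p, ∃ i, lam i = (d p).fst := by
    intro p
    have hp : (d p).fst ∈ Set.range (L.orderEmbOfFin rfl) := by
      rw [Finset.range_orderEmbOfFin]
      exact Finset.mem_image_of_mem _ (Finset.mem_univ p)
    obtain ⟨i, hi⟩ := hp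
    exact ⟨i.rev, by simpa [lam] using hi⟩
  choose g hg using hg
  have hgsurj : ∀ i, ∃ p, g p = i := by
    intro i
    obtain ⟨p, -, hp⟩ := Finset.mem_image.1 (L.orderEmbOfFin_mem rfl i.rev)
    exact ⟨p, hlam.injective ((hg p).trans hp)⟩
  let k : Fin L.card → ℕ := fun i => Fintype.card {p // g p = i}
  let e₀ (i : Fin L.card) : Fin (k i) ≃ {p // g p = i} := (Fintype.equivFin _).symm
  let σ (i : Fin L.card) : Equiv.Perm (Fin (k i)) := Tuple.sort fun j => -(d (e₀ i j)).snd
  let e : (Σ i, Fin (k i)) ≃ Fin n :=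
    (Equiv.sigmaCongrRight fun i => (σ i).trans (e₀ i)).trans (Equiv.sigmaFiberEquiv g)
  let F : DiagonalForm n :=
    { r := L.card
      lam := lam
      k := k
      mu := fun i j => (d (e₀ i (σ i j))).snd
      k_pos := fun i => Fintype.card_pos_iff.2 ((hgsurj i).elim fun p hp => ⟨⟨p, hp⟩⟩)
      sum_k := by simpa using Fintype.card_congr e
      lam_strictAnti := hlam
      mu_antitone := fun i j j' hj =>
        neg_le_neg_iff.1 (Tuple.monotone_sort (fun j => -(d (e₀ i j)).snd) hj) }
  refine ⟨F, F.position.symm.trans e, fun p => ?_⟩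
  obtain ⟨x, rfl⟩ := F.position.surjective p
  rw [diag_position]
  simp only [Equiv.trans_apply, Equiv.symm_apply_apply]
  refine TrivSqZeroExt.ext ?_ ?_
  · rw [fst_entry]
    have h := hg (e₀ x.1 (σ x.1 x.2))
    rw [(e₀ x.1 (σ x.1 x.2)).2] at h
    exact h
  · rw [snd_entry]
    rfl

end DiagonalForm

/-! ### Uniqueness of the diagonal -/

theorem commute_ofDual (d : DualNumber ℝ) (q : DualQuaternion) :
    ofDual d * q = q * ofDual d := by
  refine TrivSqZeroExt.ext ?_ ?_
  · simp [ofDual, Quaternion.coe_commutes]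
  · simp [ofDual, Quaternion.coe_commutes, add_comm]

theorem eq_of_ofDual_mul_eq {d d' : DualNumber ℝ} {q : DualQuaternion} (hq : q.fst ≠ 0)
    (h : ofDual d * q = q * ofDual d') : d = d' := by
  rw [commute_ofDual] at h
  have h₁ : (d.fst : Quaternion ℝ) = d'.fst :=
    mul_left_cancel₀ hq (by simpa [ofDual] using congrArg TrivSqZeroExt.fst h)
  -- By `h₁` the terms containing `q.snd` cancel, so again only `q.fst` has to be cancelled.
  have h₂ : (d.snd : Quaternion ℝ) = d'.snd :=
    mul_left_cancel₀ hq (by simpa [ofDual, h₁] using congrArg TrivSqZeroExt.snd h)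
  exact TrivSqZeroExt.ext (Quaternion.coe_injective h₁) (Quaternion.coe_injective h₂)

theorem sum_normSq_col {P : Matrix (Fin n) (Fin n) (Quaternion ℝ)} (hP : Pᴴ * P = 1)
    (b : Fin n) : ∑ a, Quaternion.normSq (P a b) = 1 := by
  have h := congrFun₂ hP b b
  rw [Matrix.one_apply_eq] at h
  have h' : (Pᴴ * P) b b = star (fun a => P a b) ⬝ᵥ fun a => P a b := rfl
  rw [h', Quaternion.star_dotProduct_self] at h
  exact Quaternion.coe_injective (h.trans Quaternion.coe_one.symm)

theorem sum_normSq_row {P : Matrix (Fin n) (Fin n) (Quaternion ℝ)} (hP : P * Pᴴ = 1)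
    (a : Fin n) : ∑ b, Quaternion.normSq (P a b) = 1 := by
  have h := sum_normSq_col (P := Pᴴ) (by rwa [Matrix.conjTranspose_conjTranspose]) a
  simpa using h

open Classical in
/-- The squared moduli of the entries of a unitary matrix are doubly stochastic, so a unitary
matrix that only links equal labels matches the labels with multiplicity. -/
theorem exists_perm_of_unitary {α : Type*} {P : Matrix (Fin n) (Fin n) (Quaternion ℝ)}
    (hP : Pᴴ * P = 1) (d d' : Fin n → α) (h : ∀ a b, P a b ≠ 0 → d a = d' b) :
    ∃ s : Equiv.Perm (Fin n), ∀ p, d' p = d (s p) := by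
  have hcard : ∀ t, Fintype.card {p // d' p = t} = Fintype.card {p // d p = t} := by
    intro t
    -- Columns labelled `t` carry total mass equal to their number, and so do rows. Both masses come
    -- from the same nonzero entries, since such entries link equal labels.
    have h₁ : (∑ b, ∑ a, if d' b = t then Quaternion.normSq (P a b) else 0) =
        Fintype.card {p // d' p = t} := by
      rw [Fintype.card_subtype, Finset.card_filter, Nat.cast_sum]
      refine Finset.sum_congr rfl fun b _ => ?_
      by_cases hb : d' b = t <;> simp [hb, sum_normSq_col hP]
    have h₂ : (∑ a, ∑ b, if d a = t then Quaternion.normSq (P a b) else 0) =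
        Fintype.card {p // d p = t} := by
      rw [Fintype.card_subtype, Finset.card_filter, Nat.cast_sum]
      refine Finset.sum_congr rfl fun b _ => ?_
      by_cases hb : d b = t <;> simp [hb, sum_normSq_row (mul_eq_one_comm.1 hP)]
    rw [Finset.sum_comm] at h₂
    have h₃ : (Fintype.card {p // d' p = t} : ℝ) = Fintype.card {p // d p = t} := by
      rw [← h₁, ← h₂]
      refine Finset.sum_congr rfl fun b _ => Finset.sum_congr rfl fun a _ => ?_
      by_cases hab : P a b = 0
      · simp [hab]
      · rw [h a b hab]
    exact_mod_cast h₃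
  let s : Fin n ≃ Fin n := (Equiv.sigmaFiberEquiv d').symm.trans
    ((Equiv.sigmaCongrRight fun t => Fintype.equivOfCardEq (hcard t)).trans
      (Equiv.sigmaFiberEquiv d))
  exact ⟨s, fun p => (Fintype.equivOfCardEq (hcard (d' p)) ⟨p, rfl⟩).2.symm⟩

theorem exists_perm_of_unitary_diagonalizations {A U V : Matrix (Fin n) (Fin n) DualQuaternion}
    {d d' : Fin n → DualNumber ℝ} (hU : Uᴴ * U = 1)
    (hUd : Uᴴ * A * U = (Matrix.diagonal d).map ofDual) (hV : Vᴴ * V = 1)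
    (hVd : Vᴴ * A * V = (Matrix.diagonal d').map ofDual) :
    ∃ s : Equiv.Perm (Fin n), ∀ p, d' p = d (s p) := by
  have hU' := mul_conjTranspose_eq_one hU
  have hV' := mul_conjTranspose_eq_one hV
  have hW : (Uᴴ * V)ᴴ * (Uᴴ * V) = 1 :=
    mul_conjTranspose_mul_self (by rwa [Matrix.conjTranspose_conjTranspose]) hV
  have hWst : (standardPart (Uᴴ * V))ᴴ * standardPart (Uᴴ * V) = 1 := by
    rw [← standardPart_conjTranspose, ← standardPart_mul, hW, standardPart_one]
  have hcomm : (Matrix.diagonal d).map ofDual * (Uᴴ * V) =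
      (Uᴴ * V) * (Matrix.diagonal d').map ofDual := by
    rw [← hUd, ← hVd]
    calc Uᴴ * A * U * (Uᴴ * V) = Uᴴ * A * (U * Uᴴ) * V := by simp only [Matrix.mul_assoc]
      _ = Uᴴ * (V * Vᴴ) * A * V := by rw [hU', hV', Matrix.mul_one, Matrix.mul_one]
      _ = Uᴴ * V * (Vᴴ * A * V) := by simp only [Matrix.mul_assoc]
  refine exists_perm_of_unitary hWst d d' fun a b hab => eq_of_ofDual_mul_eq hab ?_
  have h := congrFun₂ hcomm a b
  rwa [map_ofDual_diagonal, map_ofDual_diagonal, Matrix.diagonal_mul, Matrix.mul_diagonal] at h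

/-! ### Eigenvectors, right eigenvalues and multiplicities -/

theorem isRightEigenvector_col {A U : Matrix (Fin n) (Fin n) DualQuaternion}
    {d : Fin n → DualNumber ℝ} (hU : Uᴴ * U = 1)
    (hUd : Uᴴ * A * U = (Matrix.diagonal d).map ofDual) (p : Fin n) :
    IsRightEigenvector A (ofDual (d p)) (U.col p) := by
  constructor
  · by_contra! h
    have h₁ : (standardPart U)ᴴ * standardPart U = 1 := by
      rw [← standardPart_conjTranspose, ← standardPart_mul, hU, standardPart_one]
    have h₂ := sum_normSq_col h₁ p
    have h₃ : ∀ a, standardPart U a p = 0 := h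
    simp [h₃] at h₂
  · have h : A * U = U * (Matrix.diagonal d).map ofDual := by
      rw [← hUd, ← Matrix.mul_assoc, ← Matrix.mul_assoc, mul_conjTranspose_eq_one hU,
        Matrix.one_mul]
    funext a
    have h' := congrFun₂ h a p
    rw [map_ofDual_diagonal, Matrix.mul_diagonal] at h'
    exact h'

/-- The right eigenvalues of a unitarily diagonalized quaternion matrix are its diagonal
entries. -/
theorem isQuaternionRightEigenvalue_iff {B P : Matrix (Fin n) (Fin n) (Quaternion ℝ)}
    {b : Fin n → ℝ} (hP : Pᴴ * P = 1)
    (hB : Pᴴ * B * P = Matrix.diagonal fun a => (b a : Quaternion ℝ)) (q : Quaternion ℝ) :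
    IsQuaternionRightEigenvalue B q ↔ ∃ p, q = b p := by
  have hP' : P * Pᴴ = 1 := mul_eq_one_comm.1 hP
  constructor
  · rintro ⟨x, hx, hBx⟩
    have hy : Pᴴ *ᵥ x ≠ 0 := fun h => hx (by
      rw [← Matrix.one_mulVec x, ← hP', ← Matrix.mulVec_mulVec, h, Matrix.mulVec_zero])
    -- At a nonzero coordinate of y = P*x the equation reads (b p) y = y q; the real `b p` commutes
    -- with y, so cancelling gives q = b p.
    obtain ⟨p, hp⟩ := Function.ne_iff.1 hy
    have h : (Matrix.diagonal fun a => (b a : Quaternion ℝ)) *ᵥ (Pᴴ *ᵥ x) =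
        MulOpposite.op q • (Pᴴ *ᵥ x) := by
      rw [← hB, Matrix.mulVec_mulVec, Matrix.mul_assoc, hP', Matrix.mul_one,
        ← Matrix.mulVec_mulVec, hBx, ← Matrix.mulVec_smul]
      rfl
    have h' := congrFun h p
    rw [Matrix.mulVec_diagonal, Pi.smul_apply, MulOpposite.smul_eq_mul_unop,
      MulOpposite.unop_op, Quaternion.coe_commutes] at h'
    exact ⟨p, (mul_left_cancel₀ hp h').symm⟩
  · rintro ⟨p, rfl⟩
    refine ⟨P.col p, fun h => ?_, ?_⟩
    · have h₁ := sum_normSq_col hP p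
      have h₂ : ∀ a, P a p = 0 := congrFun h
      simp [h₂] at h₁
    · have h : B * P = P * Matrix.diagonal fun a => (b a : Quaternion ℝ) := by
        rw [← hB, ← Matrix.mul_assoc, ← Matrix.mul_assoc, hP', Matrix.one_mul]
      funext a
      have h' := congrFun₂ h a p
      rw [Matrix.mul_diagonal] at h'
      exact h'

/-- In the coordinates given by the columns of `P`, the eigenspace is a coordinate subspace, whose
dimension can be counted. -/
theorem mem_realEigenspace_iff_of_unitary {B P : Matrix (Fin n) (Fin n) (Quaternion ℝ)}
    {b : Fin n → ℝ} (hP : Pᴴ * P = 1)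
    (hB : Pᴴ * B * P = Matrix.diagonal fun a => (b a : Quaternion ℝ)) {t : ℝ}
    {y : Fin n → Quaternion ℝ} :
    P *ᵥ y ∈ realEigenspace B t ↔ ∀ a, b a ≠ t → y a = 0 := by
  have hP' : P * Pᴴ = 1 := mul_eq_one_comm.1 hP
  have h₁ : P *ᵥ y ∈ realEigenspace B t ↔
      (Matrix.diagonal fun a => (b a : Quaternion ℝ)) *ᵥ y =
        MulOpposite.op (t : Quaternion ℝ) • y := by
    have hinj : Function.Injective (P.mulVec) := fun x y h => by
      have h' := congrArg (Pᴴ *ᵥ ·) h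
      simpa [hP] using h'
    have hBP : B * P = P * Matrix.diagonal fun a => (b a : Quaternion ℝ) := by
      rw [← hB, ← Matrix.mul_assoc, ← Matrix.mul_assoc, hP', Matrix.one_mul]
    rw [← hinj.eq_iff, Matrix.mulVec_mulVec, ← hBP, Matrix.mulVec_smul, ← Matrix.mulVec_mulVec]
    rfl
  rw [h₁, funext_iff]
  refine forall_congr' fun a => ?_
  rw [Matrix.mulVec_diagonal, Pi.smul_apply, MulOpposite.smul_eq_mul_unop,
      MulOpposite.unop_op, Quaternion.coe_commutes]
  constructor
  · intro h hne
    by_contra hy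
    exact hne (Quaternion.coe_injective (mul_left_cancel₀ hy h))
  · intro h
    by_cases hb : b a = t
    · rw [hb]
    · rw [h hb, zero_mul, zero_mul]

/-- The multiplicity of a real right eigenvalue is the number of its occurrences on the diagonal
of a unitary diagonalization. -/
theorem eigenvalueMultiplicity_eq_card {B P : Matrix (Fin n) (Fin n) (Quaternion ℝ)}
    {b : Fin n → ℝ} (hP : Pᴴ * P = 1)
    (hB : Pᴴ * B * P = Matrix.diagonal fun a => (b a : Quaternion ℝ)) (t : ℝ) :
    eigenvalueMultiplicity B t = Nat.card {p // b p = t} := by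
  classical
  have hP' : P * Pᴴ = 1 := mul_eq_one_comm.1 hP
  -- Values are taken in the opposite ring so that the target is visibly free over the scalars.
  let f : realEigenspace B t ≃ₗ[(Quaternion ℝ)ᵐᵒᵖ] ({p // b p = t} → (Quaternion ℝ)ᵐᵒᵖ) :=
    { toFun := fun x p => MulOpposite.op ((Pᴴ *ᵥ x.1) p)
      map_add' := fun x y => by
        ext1 p
        simp [Matrix.mulVec_add]
      map_smul' := fun c x => by
        ext1 p
        simp [Matrix.mulVec_smul]
      invFun := fun y => ⟨P *ᵥ fun p => if h : b p = t then (y ⟨p, h⟩).unop else 0,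
        (mem_realEigenspace_iff_of_unitary hP hB).2 fun a ha => by simp [ha]⟩
      left_inv := fun x => by
        have hx : P *ᵥ (Pᴴ *ᵥ x.1) = x.1 := by
          rw [Matrix.mulVec_mulVec, hP', Matrix.one_mulVec]
        have hz := (mem_realEigenspace_iff_of_unitary hP hB (t := t) (y := Pᴴ *ᵥ x.1)).1
          (hx.symm ▸ x.2)
        refine Subtype.ext ?_
        refine (congrArg (P *ᵥ ·) (funext fun p => ?_)).trans hx
        by_cases h : b p = t
        · simp [h]
        · simp [h, hz p h]
      right_inv := fun y => by
        ext1 p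
        simp [hP, p.2] }
  rw [eigenvalueMultiplicity, f.finrank_eq, Module.finrank_fintype_fun_eq_card,
    Nat.card_eq_fintype_card]

theorem DiagonalForm.card_fst_diag_eq (F : DiagonalForm n) (i : Fin F.r) :
    Nat.card {p // (F.diag p).fst = F.lam i} = F.k i := by
  have e : Fin (F.k i) ≃ {p // (F.diag p).fst = F.lam i} :=
    (Equiv.sigmaSubtype i).symm.trans (F.position.subtypeEquiv fun x => by
      rw [diag_position, fst_entry, F.lam_strictAnti.injective.eq_iff])
  rw [← Nat.card_congr e, Nat.card_fin]

end DualQuaternion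

theorem theorem4p1 {n : ℕ} (A : Matrix (Fin n) (Fin n) DualQuaternion) (hA : A.IsHermitian) :
    ∃ (F : DualQuaternion.DiagonalForm n) (U : Matrix (Fin n) (Fin n) DualQuaternion),
      -- `U` is unitary and `U^* A U = Σ`
      (Uᴴ * U = 1 ∧ U * Uᴴ = 1) ∧
      Uᴴ * A * U = F.toMatrix.map DualQuaternion.ofDual ∧
      -- the columns of `U` are eigenvectors for the diagonal entries of `Σ`
      (∀ (i : Fin F.r) (j : Fin (F.k i)),
        DualQuaternion.IsRightEigenvector A (DualQuaternion.ofDual (F.entry i j))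
          (U.col (F.position ⟨i, j⟩))) ∧
      -- the `λ_i` are the right eigenvalues of `A_st`, with multiplicities `k_i`
      (∀ q : Quaternion ℝ,
        DualQuaternion.IsQuaternionRightEigenvalue (DualQuaternion.standardPart A) q ↔
          ∃ i, q = (F.lam i : Quaternion ℝ)) ∧
      (∀ i, DualQuaternion.eigenvalueMultiplicity (DualQuaternion.standardPart A) (F.lam i)
        = F.k i) ∧
      -- uniqueness of the ordered form
      (∀ (F' : DualQuaternion.DiagonalForm n) (V : Matrix (Fin n) (Fin n) DualQuaternion),
        Vᴴ * V = 1 → Vᴴ * A * V = F'.toMatrix.map DualQuaternion.ofDual → F' = F) ∧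
      -- any unitary diagonalization has the same diagonal entries, counted with multiplicity
      (∀ (d : Fin n → DualNumber ℝ) (V : Matrix (Fin n) (Fin n) DualQuaternion),
        Vᴴ * V = 1 → Vᴴ * A * V = (Matrix.diagonal d).map DualQuaternion.ofDual →
          ∃ s : Equiv.Perm (Fin n), ∀ p, d p = F.diag (s p)) := by
  obtain ⟨U₀, d, hU₀, hUd₀⟩ := DualQuaternion.exists_unitary_diagonalization hA
  obtain ⟨F, s, hs⟩ := DualQuaternion.DiagonalForm.exists_diag_eq_comp_perm d
  -- Permuting the columns of a unitary keeps it unitary and reorders the diagonal.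
  have hU : (U₀.submatrix id s)ᴴ * U₀.submatrix id s = 1 := by
    rw [Matrix.conjTranspose_submatrix,
      ← Matrix.submatrix_mul _ _ _ _ _ Function.bijective_id, hU₀, Matrix.submatrix_one_equiv]
  have hUd : (U₀.submatrix id s)ᴴ * A * U₀.submatrix id s =
      (Matrix.diagonal F.diag).map DualQuaternion.ofDual := by
    have hAs : A = A.submatrix id id := rfl
    rw [hAs, Matrix.conjTranspose_submatrix,
      ← Matrix.submatrix_mul _ _ _ _ _ Function.bijective_id,
      ← Matrix.submatrix_mul _ _ _ _ _ Function.bijective_id, hUd₀,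
      DualQuaternion.map_ofDual_diagonal, DualQuaternion.map_ofDual_diagonal,
      Matrix.submatrix_diagonal_equiv]
    exact congrArg _ (funext fun p => by rw [hs]; rfl)
  generalize U₀.submatrix id s = U at hU hUd
  have hst : (DualQuaternion.standardPart U)ᴴ * DualQuaternion.standardPart U = 1 := by
    rw [← DualQuaternion.standardPart_conjTranspose, ← DualQuaternion.standardPart_mul, hU,
      DualQuaternion.standardPart_one]
  have hstd : (DualQuaternion.standardPart U)ᴴ * DualQuaternion.standardPart A *
      DualQuaternion.standardPart U =
        Matrix.diagonal fun p => ((F.diag p).fst : Quaternion ℝ) := by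
    rw [← DualQuaternion.standardPart_diagonal, ← hUd, DualQuaternion.standardPart_mul,
      DualQuaternion.standardPart_mul, DualQuaternion.standardPart_conjTranspose]
  refine ⟨F, U, ⟨hU, DualQuaternion.mul_conjTranspose_eq_one hU⟩, hUd, fun i j => ?_, fun q => ?_,
    fun i => ?_, fun F' V hV hVd => ?_, fun d' V hV hVd => ?_⟩
  · rw [← F.diag_position ⟨i, j⟩]
    exact DualQuaternion.isRightEigenvector_col hU hUd _
  · rw [DualQuaternion.isQuaternionRightEigenvalue_iff hst hstd, ← F.position.exists_congr_right]
    constructor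
    · rintro ⟨x, hx⟩
      exact ⟨x.1, by rw [hx, F.diag_position, F.fst_entry]⟩
    · rintro ⟨i, hi⟩
      exact ⟨⟨i, ⟨0, F.k_pos i⟩⟩, by rw [hi, F.diag_position, F.fst_entry]⟩
  · rw [DualQuaternion.eigenvalueMultiplicity_eq_card hst hstd, F.card_fst_diag_eq]
  · obtain ⟨s', hs'⟩ := DualQuaternion.exists_perm_of_unitary_diagonalizations hU hUd hV hVd
    exact DualQuaternion.DiagonalForm.eq_of_diag_eq_comp_perm s' hs'
  · exact DualQuaternion.exists_perm_of_unitary_diagonalizations hU hUd hV hVd
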